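/- Let $p>4$ be an integer. Let $(s,c)$ be the holomorphic solution pair of the initial value problem $s'=c^{\,p-1}$, $c'=-s^{\,p-1}$, $s(0)=0$, $c(0)=1$ in the disc $B_r(0)\subset\mathbb{C}$ of radius $r=(p-2)^{p-2}/(p-1)^{p-1}$. Let $$K_p=\int_0^1\frac{d\zeta}{(1+\zeta^p)^{2/p}},\qquad L_p=K_p\sec(\pi/p),$$ and let $\mathbb{P}$ be the open regular $p$-gon centred at $0$ with vertices $L_p e^{\pi i n/p}$ ($n$ odd), so that $K_p$ is the midpoint of one of its edges. The quotient $s/c$ (whose denominator has no zero in $B_r(0)$) extends to a holomorphic function $t$ on $\mathbb{P}$, and $t$ has no holomorphic extension to an open set containing a vertex of $\mathbb{P}$: if $U\subseteq\mathbb{C}$ is open and contains a vertex of $\mathbb{P}$, then there is no holomorphic function $F:U\to\mathbb{C}$ with $F=t$ on $U\cap\mathbb{P}$. -/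

import Mathlib

namespace PGonTrig

/-- `(s, c)` is a holomorphic solution pair, on the open set `Ω` containing `0`, of the complex
initial value problem `s' = c ^ (p - 1)`, `c' = - s ^ (p - 1)`, `s 0 = 0`, `c 0 = 1`. -/
structure IsSolutionPair (p : ℕ) (s c : ℂ → ℂ) (Ω : Set ℂ) : Prop where
  isOpen : IsOpen Ω
  zero_mem : (0 : ℂ) ∈ Ω
  hasDerivAt_s : ∀ z ∈ Ω, HasDerivAt s (c z ^ (p - 1)) z
  hasDerivAt_c : ∀ z ∈ Ω, HasDerivAt c (-(s z ^ (p - 1))) z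
  s_zero : s 0 = 0
  c_zero : c 0 = 1

/-- The radius `(p - 2) ^ (p - 2) / (p - 1) ^ (p - 1)` of the disc about `0` in which the solution
pair is initially defined. -/
noncomputable def radius (p : ℕ) : ℝ :=
  ((p : ℝ) - 2) ^ (p - 2) / ((p : ℝ) - 1) ^ (p - 1)

/-- The inradius `K_p = ∫₀¹ dζ / (1 + ζ ^ p) ^ (2 / p)` of the `p`-gon. -/
noncomputable def inradius (p : ℕ) : ℝ :=
  ∫ x in (0 : ℝ)..1, 1 / (1 + x ^ p) ^ ((2 : ℝ) / (p : ℝ))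

/-- The circumradius `L_p = K_p * sec (π / p)` of the `p`-gon. -/
noncomputable def circumradius (p : ℕ) : ℝ :=
  inradius p / Real.cos (Real.pi / p)

/-- The vertices `L_p * exp (π i n / p)`, with `n` odd, of the regular `p`-gon that is centred at
`0` and has the positive real number `K_p` as the midpoint of one of its edges. -/
def vertices (p : ℕ) : Set ℂ :=
  {a | ∃ n : ℤ, Odd n ∧
    a = (circumradius p : ℂ) * Complex.exp ((n : ℂ) * (Real.pi : ℂ) * Complex.I / (p : ℂ))}

/-- The open regular `p`-gon. -/
def polygon (p : ℕ) : Set ℂ :=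
  interior (convexHull ℝ (vertices p))

/-- `t` is, on the open `p`-gon, the holomorphic extension of the quotient `s / c`, where `(s, c)`
is the solution pair in the disc of radius `radius p` about `0`. -/
def IsQuotientExtension (p : ℕ) (t : ℂ → ℂ) : Prop :=
  DifferentiableOn ℂ t (polygon p) ∧
    ∃ s c : ℂ → ℂ, IsSolutionPair p s c (Metric.ball 0 (radius p)) ∧
      ∀ z ∈ Metric.ball (0 : ℂ) (radius p), c z ≠ 0 ∧ t z = s z / c z

end PGonTrig

namespace PGonTrig
open Set Filter Topology MeasureTheory Metric
open scoped Interval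

/-! The extension of `s / c` is the inverse `scInv` of the Schwarz–Christoffel integral `scMap` of
`(1 + ζ ^ p) ^ (-2/p)`. This integral is injective on the unit disc (`injOn_scMap`) and its image
covers the polygon (`polygon_subset_image`). Any solution pair has `s / c = scInv` near `0`, so the
identity theorem forces `t = scInv` on the polygon (`IsQuotientExtension.eqOn_scInv`).

A vertex `a` is the image of some `ω` with `ω ^ p = -1`. A holomorphic `F` extending `t` near `a`
has `F a = ω` and satisfies `F' ^ p = (1 + F ^ p) ^ 2`. If `F'` vanishes to finite order `d` at `a`,
then `1 + F ^ p` vanishes to order `d + 1`, so `p * d = 2 * (d + 1)`, which is impossible for `p >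
4`. Hence `F' = 0` near `a`, whereas `F' ≠ 0` on the polygon (`eventually_deriv_eq_zero_of_pow_eq`,
`not_exists_extension_at_vertex`). -/

/-! ### Primitives by radial integration -/

theorem hasDerivAt_integral_segment {E : Set ℂ} (hE : IsOpen E) (hstar : StarConvex ℝ 0 E)
    {g : ℂ → ℂ} (hg : DifferentiableOn ℂ g E) {w : ℂ} (hw : w ∈ E) :
    HasDerivAt (fun z => ∫ x in (0 : ℝ)..1, z * g (x * z)) (g w) w := by
  have hmem : ∀ z ∈ E, ∀ x ∈ Icc (0 : ℝ) 1, (x : ℂ) * z ∈ E := by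
    intro z hz x hx
    have := hstar hz (a := 1 - x) (b := x) (by linarith [hx.2]) hx.1 (by ring)
    simpa using this
  have hg' : ContinuousOn (deriv g) E := (hg.deriv hE).continuousOn
  have hgc := hg.continuousOn
  obtain ⟨ε, hε, hball⟩ := Metric.nhds_basis_closedBall.mem_iff.1 (hE.mem_nhds hw)
  have hd : ∀ z ∈ E, ∀ x ∈ Icc (0 : ℝ) 1,
      HasDerivAt (fun z => z * g (x * z)) (g (x * z) + z * (x * deriv g (x * z))) z := by
    intro z hz x hx
    have h1 : HasDerivAt g (deriv g (x * z)) (x * z) :=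
      (hg.differentiableAt (hE.mem_nhds (hmem z hz x hx))).hasDerivAt
    have h2 : HasDerivAt (fun z : ℂ => (x : ℂ) * z) x z := by
      simpa using (hasDerivAt_id z).const_mul (x : ℂ)
    have := (hasDerivAt_id z).mul (h1.comp z h2)
    simp only [id, Function.comp_def] at this
    convert! this using 1
    ring
  have hc : ContinuousOn (fun q : ℝ × ℂ => g (q.1 * q.2) + q.2 * (q.1 * deriv g (q.1 * q.2)))
      (Icc (0 : ℝ) 1 ×ˢ E) := by
    have hm : MapsTo (fun q : ℝ × ℂ => (q.1 : ℂ) * q.2) (Icc (0 : ℝ) 1 ×ˢ E) E :=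
      fun q hq => hmem q.2 hq.2 q.1 hq.1
    have hm' : ContinuousOn (fun q : ℝ × ℂ => (q.1 : ℂ) * q.2) (Icc (0 : ℝ) 1 ×ˢ E) := by fun_prop
    have h1 := hgc.comp hm' hm
    have h2 := hg'.comp hm' hm
    simp only [Function.comp_def] at h1 h2
    fun_prop
  obtain ⟨C, hC⟩ := (isCompact_Icc.prod (isCompact_closedBall w ε)).exists_bound_of_continuousOn
    (hc.mono (prod_mono_right hball))
  have hcx : ∀ z ∈ E, ContinuousOn (fun x : ℝ => g (x * z) + z * (x * deriv g (x * z)))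
      (Icc (0 : ℝ) 1) := fun z hz =>
    hc.comp (f := fun x : ℝ => (x, z)) (by fun_prop) (fun x hx => ⟨hx, hz⟩)
  have hcf : ∀ z ∈ E, ContinuousOn (fun x : ℝ => z * g (x * z)) (Icc (0 : ℝ) 1) := fun z hz =>
    continuousOn_const.mul (hgc.comp (by fun_prop) (fun x hx => hmem z hz x hx))
  have hu : Ι (0 : ℝ) 1 ⊆ Icc 0 1 := by
    rw [uIoc_of_le zero_le_one]; exact Ioc_subset_Icc_self
  have key := intervalIntegral.hasDerivAt_integral_of_dominated_loc_of_deriv_le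
    (μ := volume) (a := 0) (b := 1) (bound := fun _ => C) (x₀ := w)
    (F := fun z (x : ℝ) => z * g (x * z))
    (F' := fun z (x : ℝ) => g (x * z) + z * (x * deriv g (x * z)))
    (ball_mem_nhds w hε)
    (by
      filter_upwards [hE.mem_nhds hw] with z hz
      exact ((hcf z hz).mono hu).aestronglyMeasurable measurableSet_uIoc)
    (ContinuousOn.intervalIntegrable (by rw [uIcc_of_le zero_le_one]; exact hcf w hw))
    (((hcx w hw).mono hu).aestronglyMeasurable measurableSet_uIoc)
    (ae_of_all _ fun x hx z hz => hC (x, z) ⟨hu hx, ball_subset_closedBall hz⟩)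
    intervalIntegrable_const
    (ae_of_all _ fun x hx z hz => hd z (hball (ball_subset_closedBall hz)) x (hu hx))
  convert! key.2 using 1
  -- The `z`-derivative of the integrand is also the `x`-derivative of `x * g (x * w)`, so its
  -- integral telescopes to `g w`.
  have hx : ∀ x ∈ uIcc (0 : ℝ) 1, HasDerivAt (fun x : ℝ => (x : ℂ) * g (x * w))
      (g (x * w) + w * (x * deriv g (x * w))) x := by
    intro x hx
    rw [uIcc_of_le zero_le_one] at hx
    have h1 : HasDerivAt g (deriv g (x * w)) (x * w) :=
      (hg.differentiableAt (hE.mem_nhds (hmem w hw x hx))).hasDerivAt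
    have h2 : HasDerivAt (fun x : ℝ => (x : ℂ) * w) w x := by
      simpa using (Complex.ofRealCLM.hasDerivAt (x := x)).mul_const w
    have h3 : HasDerivAt (fun x : ℝ => (x : ℂ)) 1 x := Complex.ofRealCLM.hasDerivAt
    have := h3.mul (h1.comp x h2)
    simp only [Function.comp_def] at this
    convert! this using 1
    ring
  rw [intervalIntegral.integral_eq_sub_of_hasDerivAt hx
    (ContinuousOn.intervalIntegrable (by rw [uIcc_of_le zero_le_one]; exact hcx w hw))]
  simp

/-! ### The Schwarz–Christoffel map on the closed disc -/

/-- The derivative `(1 + w ^ p) ^ (-2 / p)` of the Schwarz–Christoffel map. -/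
noncomputable def scDeriv (p : ℕ) (w : ℂ) : ℂ := (1 + w ^ p) ^ (-(2 / p) : ℂ)

/-- The Schwarz–Christoffel map of the unit disc onto the regular `p`-gon. -/
noncomputable def scMap (p : ℕ) (w : ℂ) : ℂ := ∫ x in (0 : ℝ)..1, w * scDeriv p (x * w)

/-- The set where `scDeriv` is holomorphic. -/
def scDomain (p : ℕ) : Set ℂ := {w | 1 + w ^ p ∈ Complex.slitPlane}

theorem isOpen_scDomain (p : ℕ) : IsOpen (scDomain p) :=
  Complex.isOpen_slitPlane.preimage (by fun_prop)

theorem starConvex_scDomain (p : ℕ) : StarConvex ℝ 0 (scDomain p) := by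
  rw [starConvex_zero_iff]
  intro w hw x hx0 hx1
  have hx : x ^ p ≤ 1 := pow_le_one₀ hx0 hx1
  have hx' : 0 ≤ x ^ p := by positivity
  have := Complex.starConvex_one_slitPlane hw (a := 1 - x ^ p) (b := x ^ p) (by linarith) hx'
    (by ring)
  simp only [scDomain, mem_ofPred_eq] at *
  convert this using 1
  simp [mul_pow]
  ring

theorem ball_subset_scDomain {p : ℕ} (hp : p ≠ 0) : ball (0 : ℂ) 1 ⊆ scDomain p := by
  intro w hw
  rw [mem_ball_zero_iff] at hw
  refine Or.inl ?_
  have h1 : ‖w ^ p‖ < 1 := by rw [norm_pow]; exact pow_lt_one₀ (norm_nonneg _) hw hp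
  have h2 := neg_le_of_abs_le (Complex.abs_re_le_norm (w ^ p))
  simp only [Complex.add_re, Complex.one_re]
  linarith

theorem differentiableOn_scDeriv (p : ℕ) : DifferentiableOn ℂ (scDeriv p) (scDomain p) := by
  intro w hw
  have : DifferentiableAt ℂ (fun w : ℂ => (1 + w ^ p) ^ (-(2 / p) : ℂ)) w :=
    DifferentiableAt.cpow (by fun_prop) (by fun_prop) hw
  exact this.differentiableWithinAt

theorem hasDerivAt_scMap {p : ℕ} {w : ℂ} (hw : w ∈ scDomain p) :
    HasDerivAt (scMap p) (scDeriv p w) w :=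
  hasDerivAt_integral_segment (isOpen_scDomain p) (starConvex_scDomain p)
    (differentiableOn_scDeriv p) hw

theorem scMap_zero (p : ℕ) : scMap p 0 = 0 := by simp [scMap]

theorem scMap_mul_of_pow_eq_one {p : ℕ} {u : ℂ} (hu : u ^ p = 1) (w : ℂ) :
    scMap p (u * w) = u * scMap p w := by
  rw [scMap, scMap, ← intervalIntegral.integral_const_mul]
  congr 1
  ext x
  simp only [scDeriv, mul_pow, hu]
  ring_nf

theorem norm_scDeriv (p : ℕ) (w : ℂ) :
    ‖scDeriv p w‖ = ‖1 + w ^ p‖ ^ (-(2 / p) : ℝ) := by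
  have : (-(2 / p) : ℂ) = ((-(2 / p) : ℝ) : ℂ) := by push_cast; rfl
  rw [scDeriv, this, Complex.norm_cpow_real]

theorem one_sub_le_norm_one_add_pow {p : ℕ} (hp : p ≠ 0) {x : ℝ} (hx : x ∈ Icc (0 : ℝ) 1) {w : ℂ}
    (hw : ‖w‖ ≤ 1) : 1 - x ≤ ‖1 + (x * w) ^ p‖ := by
  have h1 : ‖((x : ℂ) * w) ^ p‖ ≤ x := by
    rw [norm_pow, norm_mul, Complex.norm_real, Real.norm_of_nonneg hx.1]
    calc (x * ‖w‖) ^ p ≤ x ^ p := by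
          refine pow_le_pow_left₀ (mul_nonneg hx.1 (norm_nonneg _)) ?_ _
          nlinarith [hx.1]
      _ ≤ x := pow_le_of_le_one hx.1 hx.2 hp
  have h2 := norm_sub_norm_le (1 : ℂ) (-((x : ℂ) * w) ^ p)
  rw [norm_neg, sub_neg_eq_add, norm_one] at h2
  linarith

theorem norm_mul_scDeriv_le {p : ℕ} (hp : p ≠ 0) {x : ℝ} (hx : x ∈ Ico (0 : ℝ) 1) {w : ℂ}
    (hw : ‖w‖ ≤ 1) : ‖w * scDeriv p (x * w)‖ ≤ (1 - x) ^ (-(2 / p) : ℝ) := by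
  have h := one_sub_le_norm_one_add_pow hp ⟨hx.1, hx.2.le⟩ hw
  have h0 : 0 < 1 - x := by linarith [hx.2]
  rw [norm_mul, norm_scDeriv]
  have h3 : ‖1 + (x * w) ^ p‖ ^ (-(2 / p) : ℝ) ≤ (1 - x) ^ (-(2 / p) : ℝ) :=
    Real.rpow_le_rpow_of_nonpos h0 h (by simp; positivity)
  calc _ ≤ 1 * ‖1 + (x * w) ^ p‖ ^ (-(2 / p) : ℝ) := by gcongr
    _ ≤ _ := by rwa [one_mul]

theorem mul_mem_ball_of_lt_one {x : ℝ} (hx : x ∈ Ico (0 : ℝ) 1) {w : ℂ} (hw : ‖w‖ ≤ 1) :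
    (x : ℂ) * w ∈ ball (0 : ℂ) 1 := by
  rw [mem_ball_zero_iff, norm_mul, Complex.norm_real, Real.norm_of_nonneg hx.1]
  nlinarith [hx.1, hx.2]

theorem intervalIntegrable_one_sub_rpow {p : ℕ} (hp : 2 < p) :
    IntervalIntegrable (fun x : ℝ => (1 - x) ^ (-(2 / p) : ℝ)) volume 0 1 := by
  have hp' : (2 : ℝ) < p := by exact_mod_cast hp
  have h := (intervalIntegral.intervalIntegrable_rpow' (a := 0) (b := 1) (r := -(2 / p))
    (by rw [neg_lt_neg_iff, div_lt_one (by linarith)]; exact hp')).comp_sub_left 1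
  simpa using h.symm

/-- Dominated convergence: the bound `(1 - x) ^ (-2/p)` is uniform in `w` and integrable because `2
/ p < 1`. -/
theorem continuousOn_scMap {p : ℕ} (hp : 2 < p) : ContinuousOn (scMap p) (closedBall 0 1) := by
  have hp0 : p ≠ 0 := by omega
  have hae : ∀ᵐ x : ℝ, x ∈ Ι (0 : ℝ) 1 → x ∈ Ico (0 : ℝ) 1 := by
    have : ∀ᵐ x : ℝ, x ≠ 1 := by simp [ae_iff]
    filter_upwards [this] with x hx1 hx
    rw [uIoc_of_le zero_le_one] at hx
    exact ⟨hx.1.le, lt_of_le_of_ne hx.2 hx1⟩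
  intro w hw
  refine intervalIntegral.continuousWithinAt_of_dominated_interval
    (bound := fun x => (1 - x) ^ (-(2 / p) : ℝ)) ?_ ?_ (intervalIntegrable_one_sub_rpow hp) ?_
  · filter_upwards [self_mem_nhdsWithin] with z hz
    refine Measurable.aestronglyMeasurable ?_
    unfold scDeriv
    fun_prop
  · filter_upwards [self_mem_nhdsWithin] with z hz
    filter_upwards [hae] with x hx hx'
    exact norm_mul_scDeriv_le hp0 (hx hx') (mem_closedBall_zero_iff.1 hz)
  · filter_upwards [hae] with x hx hx'
    have h1 := ball_subset_scDomain hp0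
      (mul_mem_ball_of_lt_one (hx hx') (mem_closedBall_zero_iff.1 hw))
    have h2 : ContinuousAt (scDeriv p) (x * w) :=
      ((differentiableOn_scDeriv p).differentiableAt ((isOpen_scDomain p).mem_nhds h1)).continuousAt
    refine ContinuousAt.continuousWithinAt ?_
    exact continuousAt_id.mul (h2.comp (f := fun z : ℂ => (x : ℂ) * z) (by fun_prop))

theorem scDeriv_ne_zero {p : ℕ} {w : ℂ} (hw : w ∈ scDomain p) : scDeriv p w ≠ 0 := by
  rw [scDeriv, Complex.cpow_ne_zero_iff]
  exact Or.inl (Complex.slitPlane_ne_zero hw)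

/-- `1 + w ^ p` lies in the right half-plane, and an exponent of modulus below `1` shrinks its
argument. -/
theorem scDeriv_re_pos {p : ℕ} (hp : 2 < p) {w : ℂ} (hw : w ∈ ball (0 : ℂ) 1) :
    0 < (scDeriv p w).re := by
  have hp' : (2 : ℝ) < p := by exact_mod_cast hp
  have hw' := ball_subset_scDomain (by omega : p ≠ 0) hw
  have h0 := Complex.slitPlane_ne_zero hw'
  have hpi := Real.pi_pos
  have harg := Complex.abs_arg_le_pi (1 + w ^ p)
  have hre : 0 < (1 + w ^ p).re := by
    rw [mem_ball_zero_iff] at hw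
    have h1 : ‖w ^ p‖ < 1 := by rw [norm_pow]; exact pow_lt_one₀ (norm_nonneg _) hw (by omega)
    have h2 := neg_le_of_abs_le (Complex.abs_re_le_norm (w ^ p))
    simp only [Complex.add_re, Complex.one_re]
    linarith
  have harg : |(1 + w ^ p).arg| < Real.pi / 2 := Complex.abs_arg_lt_pi_div_two_iff.2 (Or.inl hre)
  have hexp : (-(2 / p) : ℂ) = ((-(2 / p) : ℝ) : ℂ) := by push_cast; rfl
  rw [scDeriv, Complex.cpow_def_of_ne_zero h0, Complex.exp_re]
  refine mul_pos (Real.exp_pos _) (Real.cos_pos_of_mem_Ioo ?_)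
  rw [hexp, Complex.im_mul_ofReal, Complex.log_im, mem_Ioo, ← abs_lt, abs_mul, abs_neg,
    abs_of_pos (by positivity : (0 : ℝ) < 2 / p)]
  have : (2 : ℝ) / p < 1 := by rw [div_lt_one (by linarith)]; exact hp'
  nlinarith [abs_nonneg (1 + w ^ p).arg]

/-- Noshiro–Warschawski argument: a derivative with positive real part makes the component of
`scMap` in direction `b - a` strictly increasing along the segment from `a` to `b`. -/
theorem injOn_scMap {p : ℕ} (hp : 2 < p) : InjOn (scMap p) (ball 0 1) := by
  intro a ha b hb hab
  by_contra hne
  have hseg : ∀ x ∈ Icc (0 : ℝ) 1, a + x * (b - a) ∈ ball (0 : ℂ) 1 := by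
    intro x hx
    have := (convex_ball (0 : ℂ) 1) ha hb (sub_nonneg.2 hx.2) hx.1 (sub_add_cancel 1 x)
    convert this using 1
    simp
    ring
  have hd : ∀ x ∈ Icc (0 : ℝ) 1, HasDerivAt
      (fun x : ℝ => ((starRingEnd ℂ) (b - a) * scMap p (a + x * (b - a))).re)
      ((starRingEnd ℂ) (b - a) * (scDeriv p (a + x * (b - a)) * (b - a))).re x := by
    intro x hx
    have h1 := hasDerivAt_scMap (ball_subset_scDomain (by omega : p ≠ 0) (hseg x hx))
    have h2 : HasDerivAt (fun x : ℝ => a + x * (b - a)) (b - a) x := by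
      simpa using ((Complex.ofRealCLM.hasDerivAt (x := x)).mul_const (b - a)).const_add a
    have h3 := (h1.comp x h2).const_mul ((starRingEnd ℂ) (b - a))
    exact (Complex.reCLM.hasFDerivAt.comp_hasDerivAt x h3)
  have hpos : ∀ x ∈ Icc (0 : ℝ) 1,
      0 < ((starRingEnd ℂ) (b - a) * (scDeriv p (a + x * (b - a)) * (b - a))).re := by
    intro x hx
    have : (starRingEnd ℂ) (b - a) * (scDeriv p (a + x * (b - a)) * (b - a)) =
        ((‖b - a‖ ^ 2 : ℝ) : ℂ) * scDeriv p (a + x * (b - a)) := by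
      push_cast
      rw [← Complex.conj_mul']
      ring
    rw [this, Complex.re_ofReal_mul]
    have : 0 < ‖b - a‖ := norm_pos_iff.2 (sub_ne_zero.2 (Ne.symm hne))
    exact mul_pos (by positivity) (scDeriv_re_pos hp (hseg x hx))
  have hmono : StrictMonoOn
      (fun x : ℝ => ((starRingEnd ℂ) (b - a) * scMap p (a + x * (b - a))).re) (Icc 0 1) := by
    refine strictMonoOn_of_deriv_pos (convex_Icc 0 1)
      (fun x hx => (hd x hx).continuousAt.continuousWithinAt) (fun x hx => ?_)
    rw [interior_Icc] at hx
    rw [(hd x (Ioo_subset_Icc_self hx)).deriv]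
    exact hpos x (Ioo_subset_Icc_self hx)
  have := hmono (left_mem_Icc.2 zero_le_one) (right_mem_Icc.2 zero_le_one) zero_lt_one
  simp [hab] at this

/-! ### Size of the inradius and of the initial disc -/

theorem scMap_one (p : ℕ) : scMap p 1 = inradius p := by
  rw [scMap, inradius, ← intervalIntegral.integral_ofReal]
  refine intervalIntegral.integral_congr fun x hx => ?_
  rw [uIcc_of_le zero_le_one] at hx
  have h : 0 ≤ 1 + x ^ p := by have := pow_nonneg hx.1 p; linarith
  simp only [scDeriv, one_mul, mul_one]
  push_cast
  rw [Complex.cpow_neg, one_div, Complex.ofReal_cpow h]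
  push_cast
  rfl

theorem half_le_inradius {p : ℕ} (hp : 2 ≤ p) : 1 / 2 ≤ inradius p := by
  have hp' : (2 : ℝ) ≤ p := by exact_mod_cast hp
  have hpos : ∀ x ∈ Icc (0 : ℝ) 1, 1 ≤ 1 + x ^ p := fun x hx => by
    have := pow_nonneg hx.1 p; linarith
  have h : ∀ x ∈ Icc (0 : ℝ) 1, (1 / 2 : ℝ) ≤ 1 / (1 + x ^ p) ^ ((2 : ℝ) / (p : ℝ)) := by
    intro x hx
    have h1 := hpos x hx
    have h2 : 1 + x ^ p ≤ 2 := by have := pow_le_one₀ (n := p) hx.1 hx.2; linarith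
    refine one_div_le_one_div_of_le (Real.rpow_pos_of_pos (by linarith) _) ?_
    calc (1 + x ^ p) ^ ((2 : ℝ) / p) ≤ (1 + x ^ p) ^ (1 : ℝ) :=
          Real.rpow_le_rpow_of_exponent_le h1 (by rw [div_le_one (by linarith)]; exact hp')
      _ ≤ 2 := by rwa [Real.rpow_one]
  have hint : IntervalIntegrable (fun x : ℝ => 1 / (1 + x ^ p) ^ ((2 : ℝ) / (p : ℝ)))
      volume 0 1 := by
    refine ContinuousOn.intervalIntegrable ?_
    rw [uIcc_of_le zero_le_one]
    refine continuousOn_const.div (ContinuousOn.rpow_const (by fun_prop) fun x hx => ?_)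
      fun x hx => ?_
    · exact Or.inl (by linarith [hpos x hx])
    · exact (Real.rpow_pos_of_pos (by linarith [hpos x hx]) _).ne'
  have := intervalIntegral.integral_mono_on zero_le_one intervalIntegrable_const hint h
  simpa [inradius] using this

theorem radius_le_quarter {p : ℕ} (hp : 4 < p) : radius p ≤ 1 / 4 := by
  obtain ⟨q, rfl⟩ := Nat.exists_eq_add_of_lt hp
  have hq : (0 : ℝ) ≤ q := q.cast_nonneg
  rw [radius, show 4 + q + 1 - 2 = q + 3 by omega, show 4 + q + 1 - 1 = q + 3 + 1 by omega]
  push_cast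
  rw [pow_succ _ (q + 3), div_le_div_iff₀ (mul_pos (pow_pos (by linarith) _) (by linarith))
    (by norm_num)]
  have h1 : ((4 : ℝ) + q + 1 - 2) ^ (q + 3) ≤ (4 + q + 1 - 1) ^ (q + 3) :=
    pow_le_pow_left₀ (by linarith) (by linarith) _
  have h2 : (0 : ℝ) < (4 + q + 1 - 1) ^ (q + 3) := pow_pos (by linarith) _
  nlinarith

/-! ### Images of boundary arcs and of radii -/

/-- Since `1 + e^{ipθ} = 2 cos(pθ/2) e^{ipθ/2}`, the power `-2/p` contributes the phase `e^{-iθ}`,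
which cancels `e^{iθ}`. The image of the arc therefore has vertical tangent. -/
theorem scDeriv_exp_mul_I {p : ℕ} (hp : 0 < p) {θ : ℝ} (hθ : |θ| < Real.pi / p) :
    Complex.exp (θ * Complex.I) ∈ scDomain p ∧
    ∃ r : ℝ, Complex.exp (θ * Complex.I) * scDeriv p (Complex.exp (θ * Complex.I)) = r := by
  have hp' : (0 : ℝ) < p := by exact_mod_cast hp
  have hpc : (p : ℂ) ≠ 0 := by exact_mod_cast hp.ne'
  have hlt : |p * θ / 2| < Real.pi / 2 := by
    rw [abs_div, abs_mul, abs_of_pos hp', abs_two]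
    rw [lt_div_iff₀ hp'] at hθ
    linarith
  have hcos : 0 < 2 * Real.cos (p * θ / 2) :=
    mul_pos two_pos (Real.cos_pos_of_mem_Ioo (abs_lt.1 hlt))
  have hrep : 1 + Complex.exp (θ * Complex.I) ^ p =
      Complex.exp ((Real.log (2 * Real.cos (p * θ / 2)) : ℝ) + ((p * θ / 2 : ℝ) : ℂ) * Complex.I) := by
    rw [Complex.exp_add, ← Complex.ofReal_exp, Real.exp_log hcos, ← Complex.exp_nat_mul]
    have h1 : (p : ℂ) * (θ * Complex.I) = ((p * θ / 2 : ℝ) : ℂ) * Complex.I +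
      ((p * θ / 2 : ℝ) : ℂ) * Complex.I := by push_cast; ring
    rw [h1, Complex.exp_add]
    push_cast
    rw [Complex.two_cos, add_mul, ← Complex.exp_add, ← Complex.exp_add, neg_mul,
      neg_add_cancel, Complex.exp_zero, add_comm]
  have hpi := Real.pi_pos
  have hlog : Complex.log (1 + Complex.exp (θ * Complex.I) ^ p) =
      (Real.log (2 * Real.cos (p * θ / 2)) : ℝ) + ((p * θ / 2 : ℝ) : ℂ) * Complex.I := by
    rw [hrep]
    have := abs_lt.1 hlt
    apply Complex.log_exp <;>
    simp only [Complex.add_im, Complex.ofReal_im, Complex.im_ofReal_mul,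
      Complex.I_im, zero_add, mul_one] <;> linarith
  have hne : 1 + Complex.exp (θ * Complex.I) ^ p ≠ 0 := by rw [hrep]; exact Complex.exp_ne_zero _
  refine ⟨?_, Real.exp (-(2 / p) * Real.log (2 * Real.cos (p * θ / 2))), ?_⟩
  · refine Complex.mem_slitPlane_iff_arg.2 ⟨?_, hne⟩
    rw [← Complex.log_im, hlog]
    simp only [Complex.add_im, Complex.ofReal_im, Complex.im_ofReal_mul,
      Complex.I_im, zero_add, mul_one]
    have := abs_lt.1 hlt
    linarith
  · rw [scDeriv, Complex.cpow_def_of_ne_zero hne, hlog, ← Complex.exp_add, Complex.ofReal_exp]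
    congr 1
    push_cast
    field_simp
    ring

theorem norm_exp_real_mul_I_le (θ : ℝ) : Complex.exp (θ * Complex.I) ∈ closedBall (0 : ℂ) 1 := by
  simp [Complex.norm_exp_ofReal_mul_I]

theorem re_scMap_exp_mul_I {p : ℕ} (hp : 2 < p) {θ : ℝ} (hθ : |θ| ≤ Real.pi / p) :
    (scMap p (Complex.exp (θ * Complex.I))).re = inradius p := by
  have hp' : (0 : ℝ) < p := by exact_mod_cast (by omega : 0 < p)
  have hpos : 0 < Real.pi / p := div_pos Real.pi_pos hp'
  set h : ℝ → ℝ := fun θ => (scMap p (Complex.exp (θ * Complex.I))).re with hh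
  have hc : ContinuousOn h (Icc (-(Real.pi / p)) (Real.pi / p)) :=
    Complex.continuous_re.comp_continuousOn ((continuousOn_scMap hp).comp
      (f := fun θ : ℝ => Complex.exp (θ * Complex.I)) (by fun_prop)
      (fun θ _ => norm_exp_real_mul_I_le θ))
  have hd : ∀ θ ∈ interior (Icc (-(Real.pi / p)) (Real.pi / p)), HasDerivAt h 0 θ := by
    intro θ hθ
    rw [interior_Icc, mem_Ioo, ← abs_lt] at hθ
    obtain ⟨hmem, r, hr⟩ := scDeriv_exp_mul_I (by omega : 0 < p) hθ
    have h1 : HasDerivAt (fun θ : ℝ => Complex.exp (θ * Complex.I))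
        (Complex.exp (θ * Complex.I) * Complex.I) θ := by
      simpa using ((Complex.ofRealCLM.hasDerivAt (x := θ)).mul_const Complex.I).cexp
    have h2 := Complex.reCLM.hasFDerivAt.comp_hasDerivAt θ ((hasDerivAt_scMap hmem).comp θ h1)
    convert! h2 using 1
    rw [← mul_assoc, mul_comm (scDeriv _ _), hr]
    simp
  -- The derivative is known only inside the arc; monotone plus antitone gives constancy up to the
  -- endpoints, which map to vertices.
  have hmono := monotoneOn_of_deriv_nonneg (convex_Icc _ _) hc
    (fun θ hθ => (hd θ hθ).differentiableAt.differentiableWithinAt)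
    (fun θ hθ => (hd θ hθ).deriv.ge)
  have hanti := antitoneOn_of_deriv_nonpos (convex_Icc _ _) hc
    (fun θ hθ => (hd θ hθ).differentiableAt.differentiableWithinAt)
    (fun θ hθ => (hd θ hθ).deriv.le)
  have h0 : h 0 = inradius p := by simp [hh, scMap_one]
  have hm0 : (0 : ℝ) ∈ Icc (-(Real.pi / p)) (Real.pi / p) := ⟨by linarith, by linarith⟩
  have hmθ : θ ∈ Icc (-(Real.pi / p)) (Real.pi / p) := abs_le.1 hθ
  change h θ = _
  rw [← h0]
  rcases le_total 0 θ with h' | h'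
  · exact le_antisymm (hanti hm0 hmθ h') (hmono hm0 hmθ h')
  · exact le_antisymm (hmono hmθ hm0 h') (hanti hmθ hm0 h')

theorem norm_eq_one_of_pow_eq_neg_one {p : ℕ} (hp : p ≠ 0) {ω : ℂ} (hω : ω ^ p = -1) :
    ‖ω‖ = 1 := by
  have : ‖ω‖ ^ p = 1 := by rw [← norm_pow, hω, norm_neg, norm_one]
  exact (pow_eq_one_iff_of_nonneg (norm_nonneg _) hp).1 this

theorem exists_scMap_ofReal_mul (p : ℕ) :
    ∃ g : ℝ → ℝ, ∀ ω : ℂ, ω ^ p = -1 → ∀ ρ ∈ Icc (0 : ℝ) 1, scMap p (ρ * ω) = g ρ * ω := by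
  refine ⟨fun ρ => ∫ x in (0 : ℝ)..1, ρ * (1 - (x * ρ) ^ p) ^ (-(2 / p) : ℝ), fun ω hω ρ hρ => ?_⟩
  rw [← intervalIntegral.integral_ofReal, ← intervalIntegral.integral_mul_const, scMap]
  refine intervalIntegral.integral_congr fun x hx => ?_
  rw [uIcc_of_le zero_le_one] at hx
  have h : 0 ≤ 1 - (x * ρ) ^ p := sub_nonneg.2
    (pow_le_one₀ (mul_nonneg hx.1 hρ.1) (mul_le_one₀ hx.2 hρ.1 hρ.2))
  have h2 : 1 + ((x : ℂ) * (ρ * ω)) ^ p = ((1 - (x * ρ) ^ p : ℝ) : ℂ) := by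
    rw [← mul_assoc, mul_pow, hω]
    push_cast
    ring
  simp only [scDeriv, h2]
  push_cast
  rw [← Complex.ofReal_one, ← Complex.ofReal_mul, ← Complex.ofReal_pow, ← Complex.ofReal_sub,
    Complex.ofReal_cpow h]
  push_cast
  ring

theorem exp_odd_pow {p : ℕ} (hp : p ≠ 0) {n : ℤ} (hn : Odd n) :
    Complex.exp ((n : ℂ) * (Real.pi : ℂ) * Complex.I / (p : ℂ)) ^ p = -1 := by
  have hpc : (p : ℂ) ≠ 0 := by exact_mod_cast hp
  rw [← Complex.exp_nat_mul, mul_div_cancel₀ _ hpc, mul_assoc, Complex.exp_int_mul,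
    Complex.exp_pi_mul_I, hn.neg_one_zpow]

theorem exists_of_mem_vertices {p : ℕ} (hp : p ≠ 0) {a : ℂ} (ha : a ∈ vertices p) :
    ∃ ω : ℂ, ω ^ p = -1 ∧ a = circumradius p * ω := by
  obtain ⟨n, hn, rfl⟩ := ha
  exact ⟨_, exp_odd_pow hp hn, rfl⟩

theorem cos_pi_div_pos {p : ℕ} (hp : 2 < p) : 0 < Real.cos (Real.pi / p) := by
  have hp' : (2 : ℝ) < p := by exact_mod_cast hp
  have hpi := Real.pi_pos
  have h0 : 0 < Real.pi / p := div_pos hpi (by linarith)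
  refine Real.cos_pos_of_mem_Ioo ⟨by linarith, ?_⟩
  exact div_lt_div_of_pos_left hpi two_pos hp'

theorem inradius_pos {p : ℕ} (hp : 2 < p) : 0 < inradius p := by
  linarith [half_le_inradius hp.le]

theorem circumradius_pos {p : ℕ} (hp : 2 < p) : 0 < circumradius p :=
  div_pos (inradius_pos hp) (cos_pi_div_pos hp)

theorem circumradius_mul_cos {p : ℕ} (hp : 2 < p) :
    circumradius p * Real.cos (Real.pi / p) = inradius p :=
  div_mul_cancel₀ _ (cos_pi_div_pos hp).ne'

/-- The Schwarz–Christoffel map stretches each radius towards a `p`-th root of `-1` monotonically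
onto the radius of the polygon towards a vertex. -/
theorem scMap_radius {p : ℕ} (hp : 2 < p) :
    ∃ g : ℝ → ℝ, g 1 = circumradius p ∧ (∀ ρ ∈ Ico (0 : ℝ) 1, g ρ ∈ Ico 0 (circumradius p)) ∧
      ∀ ω : ℂ, ω ^ p = -1 → ∀ ρ ∈ Icc (0 : ℝ) 1, scMap p (ρ * ω) = g ρ * ω := by
  have hp0 : p ≠ 0 := by omega
  set ω := Complex.exp (((Real.pi / p : ℝ) : ℂ) * Complex.I) with hω
  have hωp : ω ^ p = -1 := by
    rw [← exp_odd_pow hp0 odd_one, hω]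
    push_cast
    congr 2
    ring
  obtain ⟨g, hg⟩ := exists_scMap_ofReal_mul p
  have hp' : (0 : ℝ) < p := by exact_mod_cast (by omega : 0 < p)
  have hg1 : g 1 = circumradius p := by
    -- The image of `ω = e^{iπ/p}` is `g 1 * ω` and has real part `K_p`, so `g 1 = K_p / cos(π/p)`.
    have h1 := re_scMap_exp_mul_I hp (θ := Real.pi / p)
      (abs_of_pos (div_pos Real.pi_pos hp')).le
    have h2 := hg ω hωp 1 ⟨zero_le_one, le_rfl⟩
    rw [← hω] at h1
    rw [Complex.ofReal_one, one_mul] at h2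
    rw [h2, Complex.re_ofReal_mul, hω, Complex.exp_ofReal_mul_I_re] at h1
    rw [circumradius, eq_div_iff (cos_pi_div_pos hp).ne', h1]
  have hnorm : ‖ω‖ = 1 := norm_eq_one_of_pow_eq_neg_one hp0 hωp
  have hgeq : ∀ ρ ∈ Icc (0 : ℝ) 1,
      g ρ = ((starRingEnd ℂ) ω * scMap p (ρ * ω)).re := by
    intro ρ hρ
    rw [hg ω hωp ρ hρ, mul_left_comm, Complex.conj_mul', hnorm]
    simp
  have hin : ∀ ρ ∈ Ico (0 : ℝ) 1, (ρ : ℂ) * ω ∈ ball (0 : ℂ) 1 :=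
    fun ρ hρ => mul_mem_ball_of_lt_one hρ hnorm.le
  have hmono : StrictMonoOn g (Icc 0 1) := by
    refine StrictMonoOn.congr ?_ (fun ρ hρ => (hgeq ρ hρ).symm)
    refine strictMonoOn_of_deriv_pos (convex_Icc 0 1) ?_ (fun ρ hρ => ?_)
    · refine Complex.continuous_re.comp_continuousOn (continuousOn_const.mul
        ((continuousOn_scMap hp).comp (by fun_prop) (fun ρ hρ => ?_)))
      rw [mem_closedBall_zero_iff, norm_mul, hnorm, mul_one, Complex.norm_real,
        Real.norm_of_nonneg hρ.1]
      exact hρ.2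
    · rw [interior_Icc] at hρ
      have hm := hin ρ (Ioo_subset_Ico_self hρ)
      have h1 := hasDerivAt_scMap (ball_subset_scDomain hp0 hm)
      have h2 : HasDerivAt (fun x : ℝ => (x : ℂ) * ω) ω ρ := by
        simpa using (Complex.ofRealCLM.hasDerivAt (x := ρ)).mul_const ω
      have h3 := Complex.reCLM.hasFDerivAt.comp_hasDerivAt ρ
        ((h1.comp ρ h2).const_mul ((starRingEnd ℂ) ω))
      have h4 : HasDerivAt (fun ρ : ℝ => ((starRingEnd ℂ) ω * scMap p (ρ * ω)).re) _ ρ := h3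
      rw [h4.deriv, mul_left_comm, Complex.conj_mul', hnorm]
      simpa using scDeriv_re_pos hp hm
  have hg0 : g 0 = 0 := by
    rw [hgeq 0 ⟨le_rfl, zero_le_one⟩]
    simp [scMap_zero]
  refine ⟨g, hg1, fun ρ hρ => ⟨?_, ?_⟩, hg⟩
  · rw [← hg0]
    exact hmono.monotoneOn ⟨le_rfl, zero_le_one⟩ ⟨hρ.1, hρ.2.le⟩ hρ.1
  · rw [← hg1]
    exact hmono ⟨hρ.1, hρ.2.le⟩ ⟨zero_le_one, le_rfl⟩ hρ.2

/-! ### Geometry of the polygon -/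

/-- Every angle is within `π / p` of an even multiple of `π / p`. -/
theorem exists_even_mul_pi_div {p : ℕ} (hp : 0 < p) (α : ℝ) :
    ∃ k : ℤ, |α - 2 * k * Real.pi / p| ≤ Real.pi / p := by
  have hp' : (0 : ℝ) < p := by exact_mod_cast hp
  have hpi := Real.pi_pos
  refine ⟨round (α * p / (2 * Real.pi)), ?_⟩
  have h := abs_sub_round (α * p / (2 * Real.pi))
  set k := round (α * p / (2 * Real.pi))
  have : α - 2 * k * Real.pi / p = (α * p / (2 * Real.pi) - k) * (2 * Real.pi / p) := by
    field_simp
  rw [this, abs_mul, abs_of_pos (by positivity : 0 < 2 * Real.pi / p)]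
  calc _ ≤ 1 / 2 * (2 * Real.pi / p) := by gcongr
    _ = _ := by ring

/-- Every angle is within `π / p` of an odd multiple of `π / p`. -/
theorem exists_odd_mul_pi_div {p : ℕ} (hp : 0 < p) (α : ℝ) :
    ∃ n : ℤ, Odd n ∧ |α - n * Real.pi / p| ≤ Real.pi / p := by
  obtain ⟨k, hk⟩ := exists_even_mul_pi_div hp (α - Real.pi / p)
  refine ⟨2 * k + 1, ⟨k, rfl⟩, ?_⟩
  convert hk using 2
  push_cast
  ring

theorem re_le_cos_of_pow_eq_neg_one {p : ℕ} (hp : 0 < p) {ω : ℂ} (hω : ω ^ p = -1) :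
    ω.re ≤ Real.cos (Real.pi / p) := by
  have hp' : (1 : ℝ) ≤ p := by exact_mod_cast hp
  have hpi := Real.pi_pos
  have hnorm := norm_eq_one_of_pow_eq_neg_one hp.ne' hω
  have hrep : ω = Complex.exp (ω.arg * Complex.I) := by
    have := Complex.norm_mul_exp_arg_mul_I ω
    rw [hnorm, Complex.ofReal_one, one_mul] at this
    exact this.symm
  have hle : Real.pi / p ≤ |ω.arg| := by
    by_contra! hlt
    obtain ⟨hm, -⟩ := scDeriv_exp_mul_I hp hlt
    rw [← hrep] at hm
    apply Complex.slitPlane_ne_zero hm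
    rw [hω]
    ring
  rw [hrep, Complex.exp_ofReal_mul_I_re, ← Real.cos_abs]
  exact Real.cos_le_cos_of_nonneg_of_le_pi (by positivity) (Complex.abs_arg_le_pi ω) hle

theorem finite_vertices {p : ℕ} (hp : p ≠ 0) : (vertices p).Finite := by
  have hfin : {ω : ℂ | ω ^ p = -1}.Finite := by
    refine (Polynomial.nthRoots p (-1 : ℂ)).toFinset.finite_toSet.subset fun ω hω => ?_
    simpa [Polynomial.mem_nthRoots (Nat.pos_of_ne_zero hp)] using hω
  refine (hfin.image fun ω => (circumradius p : ℂ) * ω).subset fun a ha => ?_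
  obtain ⟨ω, hω, rfl⟩ := exists_of_mem_vertices hp ha
  exact ⟨ω, hω, rfl⟩

/-- A separating functional is `z ↦ Re(ū z)`. Some vertex has direction within `π / p` of `u`, so
its value there is at least `‖u‖ L_p cos(π/p) = ‖u‖ K_p`, the most it can attain on the disc. -/
theorem closedBall_subset_convexHull {p : ℕ} (hp : 2 < p) :
    closedBall 0 (inradius p) ⊆ convexHull ℝ (vertices p) := by
  intro z hz
  rw [mem_closedBall_zero_iff] at hz
  by_contra hne
  obtain ⟨l, c, hl, hlz⟩ := geometric_hahn_banach_closed_point (convex_convexHull ℝ (vertices p))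
    ((finite_vertices (by omega : p ≠ 0)).isClosed_convexHull ℝ) hne
  set u : ℂ := ⟨l 1, l Complex.I⟩ with hu
  have hlu : ∀ z, l z = ((starRingEnd ℂ) u * z).re := by
    intro z
    conv_lhs => rw [← Complex.re_add_im z]
    have h1 : (z.re : ℂ) + z.im * Complex.I = z.re • (1 : ℂ) + z.im • Complex.I := by simp
    rw [h1, map_add, map_smul, map_smul]
    simp [hu]
    ring
  have hurep := Complex.norm_mul_exp_arg_mul_I u
  obtain ⟨n, hn, hle⟩ := exists_odd_mul_pi_div (by omega : 0 < p) u.arg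
  have hv := hl _ (subset_convexHull ℝ _ (⟨n, hn, rfl⟩ : _ ∈ vertices p))
  have hval : l ((circumradius p : ℂ) * Complex.exp ((n : ℂ) * (Real.pi : ℂ) * Complex.I / (p : ℂ)))
      = ‖u‖ * circumradius p * Real.cos (u.arg - n * Real.pi / p) := by
    rw [hlu, ← hurep, map_mul, Complex.conj_ofReal, ← Complex.exp_conj]
    have : ∀ A B x y : ℂ, A * x * (B * y) = A * B * (x * y) := fun _ _ _ _ => by ring
    rw [this, ← Complex.exp_add, ← Complex.ofReal_mul, Complex.re_ofReal_mul, hurep]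
    congr 1
    rw [← Real.cos_neg, ← Complex.exp_ofReal_mul_I_re]
    congr 2
    simp
    ring
  have hcos : Real.cos (Real.pi / p) ≤ Real.cos (u.arg - n * Real.pi / p) := by
    rw [← Real.cos_abs (u.arg - _)]
    refine Real.cos_le_cos_of_nonneg_of_le_pi (abs_nonneg _) ?_ hle
    exact div_le_self Real.pi_pos.le (by exact_mod_cast (by omega : 1 ≤ p))
  have h1 : ‖u‖ * inradius p ≤ ‖u‖ * circumradius p * Real.cos (u.arg - n * Real.pi / p) := by
    rw [← circumradius_mul_cos hp, ← mul_assoc]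
    exact mul_le_mul_of_nonneg_left hcos (mul_nonneg (norm_nonneg _) (circumradius_pos hp).le)
  have h2 : l z ≤ ‖u‖ * inradius p := by
    rw [hlu]
    refine (Complex.re_le_norm _).trans ?_
    rw [norm_mul, RCLike.norm_conj]
    gcongr
  linarith

theorem ball_inradius_subset_polygon {p : ℕ} (hp : 2 < p) : ball 0 (inradius p) ⊆ polygon p :=
  interior_maximal (ball_subset_closedBall.trans (closedBall_subset_convexHull hp)) isOpen_ball

theorem isOpen_polygon (p : ℕ) : IsOpen (polygon p) := isOpen_interior

theorem convex_polygon (p : ℕ) : Convex ℝ (polygon p) := (convex_convexHull ℝ _).interior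

theorem zero_mem_polygon {p : ℕ} (hp : 2 < p) : (0 : ℂ) ∈ polygon p :=
  ball_inradius_subset_polygon hp (mem_ball_self (inradius_pos hp))

theorem ball_radius_subset_polygon {p : ℕ} (hp : 4 < p) : ball 0 (radius p) ⊆ polygon p :=
  (ball_subset_ball (by
    linarith [radius_le_quarter hp, half_le_inradius (by omega : 2 ≤ p)])).trans
    (ball_inradius_subset_polygon (by omega))

theorem re_mul_lt_inradius {p : ℕ} (hp : 2 < p) {u : ℂ} (hu : u ^ p = 1) {z : ℂ}
    (hz : z ∈ polygon p) : (u * z).re < inradius p := by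
  have hle : ∀ z ∈ polygon p, (u * z).re ≤ inradius p := by
    have hconv : Convex ℝ {z : ℂ | (u * z).re ≤ inradius p} :=
      convex_halfSpace_le ⟨fun x y => by rw [mul_add, Complex.add_re],
        fun c x => by simp [mul_sub, mul_left_comm]⟩ _
    have hsub : vertices p ⊆ {z : ℂ | (u * z).re ≤ inradius p} := by
      intro a ha
      obtain ⟨ω, hω, rfl⟩ := exists_of_mem_vertices (by omega) ha
      rw [mem_ofPred_eq, mul_left_comm, Complex.re_ofReal_mul, ← circumradius_mul_cos hp]
      refine mul_le_mul_of_nonneg_left ?_ (circumradius_pos hp).le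
      exact re_le_cos_of_pow_eq_neg_one (by omega) (by rw [mul_pow, hu, hω, one_mul])
    exact fun z hz => convexHull_min hsub hconv (interior_subset hz)
  -- Equality would fail the weak bound at `(1 + δ) * z`, which stays in the open polygon for small
  -- `δ > 0`.
  by_contra! hge
  have hK := inradius_pos hp
  have htend : Tendsto (fun δ : ℝ => ((1 + δ : ℝ) : ℂ) * z) (𝓝[>] 0) (𝓝 z) := by
    have : ContinuousAt (fun δ : ℝ => ((1 + δ : ℝ) : ℂ) * z) 0 := by fun_prop
    have h := this.tendsto.mono_left (nhdsWithin_le_nhds (s := Ioi 0))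
    simpa using h
  obtain ⟨δ, hδz, hδ⟩ := ((htend.eventually ((isOpen_polygon p).mem_nhds hz)).and
    self_mem_nhdsWithin).exists
  have h1 := hle _ hδz
  rw [mul_left_comm, Complex.re_ofReal_mul] at h1
  have hδ' : 0 < δ := hδ
  nlinarith

/-- A rotation by a `p`-th root of unity moves `w` to the arc whose image lies on the edge line `Re
= K_p`. -/
theorem scMap_notMem_polygon {p : ℕ} (hp : 2 < p) {w : ℂ} (hw : ‖w‖ = 1) :
    scMap p w ∉ polygon p := by
  intro hz
  have hpc : (p : ℂ) ≠ 0 := by exact_mod_cast (by omega : p ≠ 0)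
  obtain ⟨k, hk⟩ := exists_even_mul_pi_div (by omega : 0 < p) w.arg
  set u := Complex.exp (-(2 * k * Real.pi / p : ℝ) * Complex.I) with hu
  have hup : u ^ p = 1 := by
    rw [hu, ← Complex.exp_nat_mul, Complex.exp_eq_one_iff]
    refine ⟨-k, ?_⟩
    push_cast
    field_simp
  have huw : u * w = Complex.exp ((w.arg - 2 * k * Real.pi / p : ℝ) * Complex.I) := by
    have := Complex.norm_mul_exp_arg_mul_I w
    rw [hw, Complex.ofReal_one, one_mul] at this
    rw [← this, hu, ← Complex.exp_add, this]
    congr 1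
    push_cast
    ring
  have h1 := re_mul_lt_inradius hp hup hz
  rw [← scMap_mul_of_pow_eq_one hup, huw, re_scMap_exp_mul_I hp hk] at h1
  exact lt_irrefl _ h1

/-! ### The inverse map on the polygon -/

theorem hasStrictDerivAt_scMap {p : ℕ} {w : ℂ} (hw : w ∈ scDomain p) :
    HasStrictDerivAt (scMap p) (scDeriv p w) w := by
  have hd : DifferentiableOn ℂ (scMap p) (scDomain p) := fun z hz =>
    (hasDerivAt_scMap hz).differentiableAt.differentiableWithinAt
  have h := (hd.analyticAt ((isOpen_scDomain p).mem_nhds hw)).hasStrictDerivAt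
  rwa [(hasDerivAt_scMap hw).deriv] at h

/-- The image of the disc is open, and relatively closed in the polygon: limit points come from the
compact closed disc, and the circle misses the polygon. Connectedness concludes. -/
theorem polygon_subset_image {p : ℕ} (hp : 2 < p) : polygon p ⊆ scMap p '' ball 0 1 := by
  have hopen : IsOpen (scMap p '' ball 0 1) := by
    rw [isOpen_iff_mem_nhds]
    rintro _ ⟨w, hw, rfl⟩
    have hw' := ball_subset_scDomain (by omega : p ≠ 0) hw
    rw [← (hasStrictDerivAt_scMap hw').map_nhds_eq (scDeriv_ne_zero hw')]
    exact image_mem_map (isOpen_ball.mem_nhds hw)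
  have hclosed : IsClosed (scMap p '' closedBall 0 1) :=
    ((isCompact_closedBall 0 1).image_of_continuousOn (continuousOn_scMap hp)).isClosed
  refine (convex_polygon p).isPreconnected.subset_of_closure_inter_subset hopen
    ⟨0, zero_mem_polygon hp, 0, mem_ball_self one_pos, scMap_zero p⟩ ?_
  rintro z ⟨hz, hzP⟩
  obtain ⟨w, hw, rfl⟩ := closure_minimal (image_mono ball_subset_closedBall) hclosed hz
  rw [mem_closedBall_zero_iff] at hw
  refine ⟨w, ?_, rfl⟩
  rw [mem_ball_zero_iff]
  exact lt_of_le_of_ne hw fun h => scMap_notMem_polygon hp h hzP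

/-- The inverse of the Schwarz–Christoffel map. -/
noncomputable def scInv (p : ℕ) : ℂ → ℂ := Function.invFunOn (scMap p) (ball 0 1)

theorem scInv_mem {p : ℕ} (hp : 2 < p) {z : ℂ} (hz : z ∈ polygon p) : scInv p z ∈ ball (0 : ℂ) 1 :=
  Function.invFunOn_mem (polygon_subset_image hp hz)

theorem scMap_scInv {p : ℕ} (hp : 2 < p) {z : ℂ} (hz : z ∈ polygon p) : scMap p (scInv p z) = z :=
  Function.invFunOn_eq (polygon_subset_image hp hz)

theorem scInv_scMap {p : ℕ} (hp : 2 < p) {w : ℂ} (hw : w ∈ ball (0 : ℂ) 1) :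
    scInv p (scMap p w) = w :=
  (injOn_scMap hp).leftInvOn_invFunOn hw

theorem scInv_zero {p : ℕ} (hp : 2 < p) : scInv p 0 = 0 := by
  simpa [scMap_zero] using scInv_scMap hp (mem_ball_self one_pos)

theorem hasDerivAt_scInv {p : ℕ} (hp : 2 < p) {z : ℂ} (hz : z ∈ polygon p) :
    HasDerivAt (scInv p) (scDeriv p (scInv p z))⁻¹ z := by
  have hm := scInv_mem hp hz
  have hm' := ball_subset_scDomain (by omega : p ≠ 0) hm
  have h := (hasStrictDerivAt_scMap hm').to_local_left_inverse (scDeriv_ne_zero hm')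
    (g := scInv p) (by
      filter_upwards [isOpen_ball.mem_nhds hm] with w hw using scInv_scMap hp hw)
  rw [scMap_scInv hp hz] at h
  exact h.hasDerivAt

theorem differentiableOn_scInv {p : ℕ} (hp : 2 < p) : DifferentiableOn ℂ (scInv p) (polygon p) :=
  fun _ hz => (hasDerivAt_scInv hp hz).differentiableAt.differentiableWithinAt

/-! ### Existence of the extension -/

/-- The generalized cosine on the whole polygon. -/
noncomputable def pCos (p : ℕ) (z : ℂ) : ℂ := (1 + scInv p z ^ p) ^ (-(1 / p) : ℂ)

theorem pCos_pow {p : ℕ} (hp : p ≠ 0) (z : ℂ) : pCos p z ^ p = (1 + scInv p z ^ p)⁻¹ := by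
  have hpc : (p : ℂ) ≠ 0 := by exact_mod_cast hp
  rw [pCos, ← Complex.cpow_nat_mul, ← Complex.cpow_neg_one]
  congr 1
  field_simp

theorem pCos_sq (p : ℕ) (z : ℂ) : pCos p z ^ 2 = scDeriv p (scInv p z) := by
  rw [pCos, ← Complex.cpow_nat_mul, scDeriv]
  congr 1
  push_cast
  ring

theorem pCos_ne_zero {p : ℕ} (hp : 2 < p) {z : ℂ} (hz : z ∈ polygon p) : pCos p z ≠ 0 := by
  rw [pCos, Complex.cpow_ne_zero_iff]
  exact Or.inl (Complex.slitPlane_ne_zero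
    (ball_subset_scDomain (by omega : p ≠ 0) (scInv_mem hp hz)))

theorem hasDerivAt_pCos {p : ℕ} (hp : 2 < p) {z : ℂ} (hz : z ∈ polygon p) :
    HasDerivAt (pCos p) (-((scInv p z * pCos p z) ^ (p - 1))) z := by
  have hp0 : p ≠ 0 := by omega
  have hpc : (p : ℂ) ≠ 0 := by exact_mod_cast hp0
  have hA := ball_subset_scDomain hp0 (scInv_mem hp hz)
  have hc := pCos_ne_zero hp hz
  have h := (((hasDerivAt_scInv hp hz).pow p).const_add 1).cpow_const (c := (-(1 / p) : ℂ)) hA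
  convert! h using 1
  have h0 := Complex.slitPlane_ne_zero hA
  have h1 : (1 + scInv p z ^ p) ^ (-(1 / p) - 1 : ℂ) = pCos p z * pCos p z ^ p := by
    rw [Complex.cpow_sub _ _ h0, Complex.cpow_one, pCos_pow hp0, pCos]
    rfl
  rw [Pi.pow_apply, h1, ← pCos_sq, mul_pow]
  obtain ⟨q, rfl⟩ := Nat.exists_eq_add_of_lt hp
  rw [show 2 + q + 1 - 1 = q + 2 by omega]
  field_simp
  ring

/-- With `t = scInv`, `c = (1 + t ^ p) ^ (-1/p)` and `s = t * c`, the equations follow from `t' =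
c⁻²` and `c ^ p * (1 + t ^ p) = 1`. -/
theorem isSolutionPair_polygon {p : ℕ} (hp : 2 < p) :
    IsSolutionPair p (fun z => scInv p z * pCos p z) (pCos p) (polygon p) where
  isOpen := isOpen_polygon p
  zero_mem := zero_mem_polygon hp
  hasDerivAt_s z hz := by
    have hp0 : p ≠ 0 := by omega
    have hA := Complex.slitPlane_ne_zero (ball_subset_scDomain hp0 (scInv_mem hp hz))
    have hc := pCos_ne_zero hp hz
    convert! (hasDerivAt_scInv hp hz).mul (hasDerivAt_pCos hp hz) using 1
    have h1 : pCos p z ^ p * (1 + scInv p z ^ p) = 1 := by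
      rw [pCos_pow hp0, inv_mul_cancel₀ hA]
    rw [← pCos_sq]
    obtain ⟨q, rfl⟩ := Nat.exists_eq_add_of_lt hp
    rw [show 2 + q + 1 - 1 = q + 2 by omega]
    field_simp
    linear_combination h1
  hasDerivAt_c z hz := hasDerivAt_pCos hp hz
  s_zero := by simp [scInv_zero hp]
  c_zero := by
    have hp0 : p ≠ 0 := by omega
    simp [pCos, scInv_zero hp, hp0]

theorem radius_pos {p : ℕ} (hp : 2 < p) : 0 < radius p := by
  have : (2 : ℝ) < p := by exact_mod_cast hp
  exact div_pos (pow_pos (by linarith) _) (pow_pos (by linarith) _)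

theorem exists_isQuotientExtension {p : ℕ} (hp : 4 < p) : IsQuotientExtension p (scInv p) := by
  have hp2 : 2 < p := by omega
  have hsub := ball_radius_subset_polygon hp
  have h := isSolutionPair_polygon hp2
  refine ⟨differentiableOn_scInv hp2, fun z => scInv p z * pCos p z, pCos p,
    ⟨isOpen_ball, mem_ball_self (radius_pos hp2), fun z hz => h.hasDerivAt_s z (hsub hz),
      fun z hz => h.hasDerivAt_c z (hsub hz), h.s_zero, h.c_zero⟩, fun z hz => ?_⟩
  have hc := pCos_ne_zero hp2 (hsub hz)
  exact ⟨hc, (mul_div_cancel_right₀ _ hc).symm⟩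

/-! ### Uniqueness of the extension -/

theorem IsSolutionPair.pow_add_pow {p : ℕ} (hp : 1 < p) {s c : ℂ → ℂ} {Ω : Set ℂ}
    (h : IsSolutionPair p s c Ω) (hΩ : IsPreconnected Ω) {z : ℂ} (hz : z ∈ Ω) :
    s z ^ p + c z ^ p = 1 := by
  have hd : ∀ z ∈ Ω, HasDerivAt (fun z => s z ^ p + c z ^ p) 0 z := by
    intro z hz
    convert! ((h.hasDerivAt_s z hz).pow p).add ((h.hasDerivAt_c z hz).pow p) using 1
    ring
  have := h.isOpen.is_const_of_deriv_eq_zero hΩ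
    (fun z hz => (hd z hz).differentiableAt.differentiableWithinAt)
    (fun z hz => (hd z hz).deriv) hz h.zero_mem
  have hp0 : p ≠ 0 := by omega
  simpa [h.s_zero, h.c_zero, hp0] using this

/-- From `s ^ p + c ^ p = 1` one gets `(s / c)' = c⁻²` and `scDeriv p (s / c) = c ^ 2`, so `scMap p
(s / c) - z` is constant near `0`. -/
theorem IsSolutionPair.div_eventuallyEq {p : ℕ} (hp : 2 < p) {s c : ℂ → ℂ} {Ω : Set ℂ}
    (h : IsSolutionPair p s c Ω) (hΩ : IsPreconnected Ω) :
    (fun z => s z / c z) =ᶠ[𝓝 0] scInv p := by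
  have hp0 : p ≠ 0 := by omega
  have hp' : (0 : ℝ) < p := by exact_mod_cast (by omega : 0 < p)
  have hsc := (h.hasDerivAt_s 0 h.zero_mem).continuousAt
  have hcc := (h.hasDerivAt_c 0 h.zero_mem).continuousAt
  have hc0 : c 0 ≠ 0 := by simp [h.c_zero]
  have hτ : ContinuousAt (fun z => s z / c z) 0 := hsc.div hcc hc0
  have e1 : ∀ᶠ z in 𝓝 0, s z / c z ∈ ball (0 : ℂ) 1 :=
    hτ.eventually (isOpen_ball.mem_nhds (by simp [h.s_zero]))
  have e2 : ∀ᶠ z in 𝓝 0, c z ≠ 0 := hcc.eventually_ne hc0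
  -- This keeps the principal branch: `(c⁻¹ ^ p) ^ (-2/p) = c ^ 2` needs `p * arg c⁻¹` within `(-π,
  -- π)`.
  have e3 : ∀ᶠ z in 𝓝 0, |(c z)⁻¹.arg| < Real.pi / p := by
    have : ContinuousAt (fun z => |(c z)⁻¹.arg|) 0 :=
      
      ((Complex.continuousAt_arg (by simp [h.c_zero])).comp (hcc.inv₀ hc0)).abs
    refine this.eventually_lt_const ?_
    simpa [h.c_zero] using div_pos Real.pi_pos hp'
  obtain ⟨ε, hε, hball⟩ := Metric.eventually_nhds_iff_ball.1
    (((e1.and e2).and e3).and (h.isOpen.mem_nhds h.zero_mem))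
  have hd : ∀ z ∈ ball (0 : ℂ) ε, HasDerivAt (fun z => scMap p (s z / c z) - z) 0 z := by
    intro z hz
    obtain ⟨⟨⟨h1, h2⟩, h3⟩, h4⟩ := hball z hz
    have hpy := h.pow_add_pow (by omega) hΩ h4
    have hA : 1 + (s z / c z) ^ p = (c z)⁻¹ ^ p := by
      rw [div_pow, inv_pow]
      field_simp
      linear_combination hpy
    have hder : scDeriv p (s z / c z) = c z ^ 2 := by
      have hpc : (p : ℂ) ≠ 0 := by exact_mod_cast hp0
      rw [lt_div_iff₀ hp', mul_comm, ← abs_of_pos hp', ← abs_mul] at h3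
      obtain ⟨h5, h6⟩ := abs_lt.1 h3
      rw [scDeriv, hA, ← Complex.cpow_nat_mul' h5 h6.le, mul_neg, mul_div_cancel₀ _ hpc,
        Complex.cpow_neg, Complex.cpow_ofNat, inv_pow, inv_inv]
    have h9 := ((hasDerivAt_scMap (ball_subset_scDomain hp0 h1)).comp z
      ((h.hasDerivAt_s z h4).div (h.hasDerivAt_c z h4) h2)).sub (hasDerivAt_id z)
    convert! h9 using 1
    change 0 = scDeriv p (s z / c z) * _ - 1
    rw [hder]
    obtain ⟨q, rfl⟩ := Nat.exists_eq_add_of_lt hp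
    rw [show 2 + q + 1 - 1 = q + 2 by omega]
    field_simp
    linear_combination -hpy
  filter_upwards [ball_mem_nhds 0 hε] with z hz
  have h1 := isOpen_ball.is_const_of_deriv_eq_zero (convex_ball (0 : ℂ) ε).isPreconnected
    (fun z hz => (hd z hz).differentiableAt.differentiableWithinAt)
    (fun z hz => (hd z hz).deriv) hz (mem_ball_self hε)
  simp only [h.s_zero, zero_div, scMap_zero, sub_zero, sub_eq_zero] at h1
  rw [← scInv_scMap hp (hball z hz).1.1.1, h1]

theorem IsQuotientExtension.eqOn_scInv {p : ℕ} (hp : 4 < p) {t : ℂ → ℂ}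
    (ht : IsQuotientExtension p t) : EqOn t (scInv p) (polygon p) := by
  have hp2 : 2 < p := by omega
  obtain ⟨hd, s, c, hsc, hq⟩ := ht
  refine (hd.analyticOnNhd (isOpen_polygon p)).eqOn_of_preconnected_of_eventuallyEq
    ((differentiableOn_scInv hp2).analyticOnNhd (isOpen_polygon p))
    (convex_polygon p).isPreconnected (zero_mem_polygon hp2) ?_
  filter_upwards [hsc.div_eventuallyEq hp2 (convex_ball _ _).isPreconnected,
    isOpen_ball.mem_nhds hsc.zero_mem] with z h1 h2
  rw [(hq z h2).2, h1]

/-! ### No extension at a vertex -/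

theorem eventually_deriv_eq_zero_of_pow_eq {p : ℕ} (hp : 4 < p) {F : ℂ → ℂ} {a : ℂ}
    (hF : AnalyticAt ℂ F a) (ha : F a ^ p = -1)
    (hode : ∀ᶠ z in 𝓝 a, deriv F z ^ p = (1 + F z ^ p) ^ 2) : ∀ᶠ z in 𝓝 a, deriv F z = 0 := by
  have hp0 : p ≠ 0 := by omega
  have hFa : F a ≠ 0 := by
    intro h
    simp [h, hp0] at ha
  rw [← analyticOrderAt_eq_top]
  -- The cofactor in `F ^ p - F a ^ p = (F - F a) * Q`; it is nonzero at `a`, so `1 + F ^ p` and `F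
  -- - F a` have the same order.
  set Q : ℂ → ℂ := fun z => ∑ i ∈ Finset.range p, F z ^ i * F a ^ (p - 1 - i) with hQ
  have hQan : AnalyticAt ℂ Q a := by fun_prop
  have hQa : Q a ≠ 0 := by
    have : Q a = p * F a ^ (p - 1) := by
      rw [hQ]
      simp only
      rw [Finset.sum_congr rfl (g := fun _ => F a ^ (p - 1))]
      · simp
      · intro i hi
        rw [Finset.mem_range] at hi
        rw [← pow_add]
        congr 1
        omega
    rw [this]
    exact mul_ne_zero (by exact_mod_cast hp0) (pow_ne_zero _ hFa)
  have hfac : (fun z => 1 + F z ^ p) = (fun z => F z - F a) * Q := by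
    ext z
    rw [Pi.mul_apply, mul_comm, hQ]
    simp only
    rw [(Commute.all (F z) (F a)).geom_sum₂_mul, ha]
    ring
  have hd1 : analyticOrderAt (deriv F) a + 1 = analyticOrderAt (fun z => F z - F a) a :=
    hF.analyticOrderAt_deriv_add_one
  have hord : analyticOrderAt (fun z => 1 + F z ^ p) a = analyticOrderAt (deriv F) a + 1 := by
    rw [hfac, analyticOrderAt_mul (by fun_prop) hQan, hQan.analyticOrderAt_eq_zero.2 hQa, add_zero,
      hd1]
  have heq : (deriv F) ^ p =ᶠ[𝓝 a] (fun z => 1 + F z ^ p) ^ 2 := hode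
  have h := analyticOrderAt_congr heq
  rw [analyticOrderAt_pow hF.deriv, analyticOrderAt_pow (by fun_prop), hord] at h
  by_contra hne
  obtain ⟨d, hd⟩ := ENat.ne_top_iff_exists.1 hne
  rw [← hd] at h
  simp only [nsmul_eq_mul] at h
  -- Impossible for `p > 4`, while `p = 3, d = 2` and `p = 4, d = 1` are solutions.
  have h' : p * d = 2 * (d + 1) := by exact_mod_cast h
  rcases Nat.eq_zero_or_pos d with rfl | hpos
  · omega
  · nlinarith

theorem not_exists_extension_at_vertex {p : ℕ} (hp : 4 < p) {a : ℂ} (ha : a ∈ vertices p)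
    {U : Set ℂ} (hU : IsOpen U) (haU : a ∈ U) {F : ℂ → ℂ} (hF : DifferentiableOn ℂ F U)
    (hFt : EqOn F (scInv p) (U ∩ polygon p)) : False := by
  have hp2 : 2 < p := by omega
  have hp0 : p ≠ 0 := by omega
  have hL := circumradius_pos hp2
  have hav := ha
  obtain ⟨ω, hω, rfl⟩ := exists_of_mem_vertices hp0 ha
  have hnorm := norm_eq_one_of_pow_eq_neg_one hp0 hω
  have hω0 : ω ≠ 0 := by
    rw [← norm_pos_iff, hnorm]
    exact one_pos
  obtain ⟨g, hg1, hg, hgω⟩ := scMap_radius hp2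
  have hFan : AnalyticAt ℂ F (circumradius p * ω) := hF.analyticAt (hU.mem_nhds haU)
  have hpath : Tendsto (fun ρ : ℝ => scMap p (ρ * ω)) (𝓝[Ico 0 1] 1)
      (𝓝 (circumradius p * ω)) := by
    have h1 : scMap p ((1 : ℝ) * ω) = circumradius p * ω := by
      rw [hgω ω hω 1 ⟨zero_le_one, le_rfl⟩, hg1]
    rw [← h1]
    refine Tendsto.mono_left ?_ (nhdsWithin_mono _ Ico_subset_Icc_self)
    refine ((continuousOn_scMap hp2).comp (s := Icc (0 : ℝ) 1) (f := fun ρ : ℝ => (ρ : ℂ) * ω)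
      (by fun_prop) (fun ρ hρ => ?_)) 1 ⟨zero_le_one, le_rfl⟩
    rw [mem_closedBall_zero_iff, norm_mul, hnorm, mul_one, Complex.norm_real,
      Real.norm_of_nonneg hρ.1]
    exact hρ.2
  have hne : NeBot (𝓝[Ico (0 : ℝ) 1] 1) := by
    rw [← mem_closure_iff_nhdsWithin_neBot, closure_Ico zero_ne_one]
    exact ⟨zero_le_one, le_rfl⟩
  have hpoly : ∀ ρ ∈ Ico (0 : ℝ) 1, scMap p (ρ * ω) ∈ polygon p := by
    intro ρ hρ
    rw [hgω ω hω ρ ⟨hρ.1, hρ.2.le⟩]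
    have h1 := (convex_convexHull ℝ (vertices p)).combo_interior_self_mem_interior
      (x := 0) (y := circumradius p * ω) (a := 1 - g ρ / circumradius p)
      (b := g ρ / circumradius p) (zero_mem_polygon hp2) (subset_convexHull ℝ _ hav)
      (by rw [sub_pos, div_lt_one hL]; exact (hg ρ hρ).2) (div_nonneg (hg ρ hρ).1 hL.le)
      (by ring)
    rwa [smul_zero, zero_add, Complex.real_smul, ← mul_assoc, ← Complex.ofReal_mul,
      div_mul_cancel₀ _ hL.ne'] at h1
  have hneq : ∀ ρ ∈ Ico (0 : ℝ) 1, scMap p (ρ * ω) ≠ circumradius p * ω := by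
    intro ρ hρ h
    rw [hgω ω hω ρ ⟨hρ.1, hρ.2.le⟩] at h
    have := mul_right_cancel₀ hω0 h
    exact (hg ρ hρ).2.ne (by exact_mod_cast this)
  have hpath' : Tendsto (fun ρ : ℝ => scMap p (ρ * ω)) (𝓝[Ico 0 1] 1)
      (𝓝[≠] (circumradius p * ω)) := tendsto_nhdsWithin_iff.2
    ⟨hpath, eventually_mem_nhdsWithin.mono hneq⟩
  -- Along the image of the radius `ρ * ω`, `F` takes the value `ρ * ω`; let `ρ` tend to `1`.
  have hval : F (circumradius p * ω) = ω := by
    have h1 := hFan.continuousAt.tendsto.comp hpath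
    have h2 : Tendsto (fun ρ : ℝ => (ρ : ℂ) * ω) (𝓝[Ico 0 1] 1) (𝓝 ω) := by
      have : ContinuousAt (fun ρ : ℝ => (ρ : ℂ) * ω) 1 := by fun_prop
      simpa using this.tendsto.mono_left (nhdsWithin_le_nhds (s := Ico 0 1))
    refine tendsto_nhds_unique h1 (h2.congr' ?_)
    filter_upwards [self_mem_nhdsWithin, hpath.eventually (hU.mem_nhds haU)] with ρ hρ hρU
    rw [Function.comp_apply, hFt ⟨hρU, hpoly ρ hρ⟩,
      scInv_scMap hp2 (mul_mem_ball_of_lt_one hρ hnorm.le)]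
  have hderiv : ∀ z ∈ U ∩ polygon p, deriv F z = (scDeriv p (F z))⁻¹ ∧ F z ∈ scDomain p := by
    intro z hz
    have h1 : F =ᶠ[𝓝 z] scInv p := hFt.eventuallyEq_of_mem
      ((hU.inter (isOpen_polygon p)).mem_nhds hz)
    rw [h1.deriv_eq, hFt hz, (hasDerivAt_scInv hp2 hz.2).deriv]
    exact ⟨rfl, ball_subset_scDomain hp0 (scInv_mem hp2 hz.2)⟩
  have hfreq : ∃ᶠ z in 𝓝[≠] (circumradius p * ω), z ∈ U ∩ polygon p := by
    refine hpath'.frequently (Eventually.frequently ?_)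
    filter_upwards [self_mem_nhdsWithin, hpath.eventually (hU.mem_nhds haU)] with ρ hρ hρU
    exact ⟨hρU, hpoly ρ hρ⟩
  -- The `p`-th power removes the branch of the root, so both sides are analytic at the vertex and
  -- the identity spreads from the polygon to a full neighbourhood.
  have hode : ∀ᶠ z in 𝓝 (circumradius p * ω), deriv F z ^ p = (1 + F z ^ p) ^ 2 := by
    refine (AnalyticAt.frequently_eq_iff_eventually_eq (hFan.deriv.pow p)
      ((analyticAt_const.add (hFan.pow p)).pow 2)).1 (hfreq.mono fun z hz => ?_)
    have hpc : (p : ℂ) ≠ 0 := by exact_mod_cast hp0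
    change deriv F z ^ p = (1 + F z ^ p) ^ 2
    rw [(hderiv z hz).1, scDeriv, ← Complex.cpow_neg, neg_neg, ← Complex.cpow_nat_mul,
      mul_div_cancel₀ _ hpc]
    exact_mod_cast Complex.cpow_natCast (1 + F z ^ p) 2
  have hzero := eventually_deriv_eq_zero_of_pow_eq hp hFan (by rw [hval, hω]) hode
  obtain ⟨z, hz, hz0⟩ := (hfreq.and_eventually (hzero.filter_mono nhdsWithin_le_nhds)).exists
  rw [(hderiv z hz).1, inv_eq_zero] at hz0
  exact scDeriv_ne_zero (hderiv z hz).2 hz0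

end PGonTrig

theorem theorem14 (p : ℕ) (hp : 4 < p) :
    (∃ t : ℂ → ℂ, PGonTrig.IsQuotientExtension p t) ∧
    ∀ t : ℂ → ℂ, PGonTrig.IsQuotientExtension p t →
      ∀ a ∈ PGonTrig.vertices p, ∀ U : Set ℂ, IsOpen U → a ∈ U →
        ¬ ∃ F : ℂ → ℂ, DifferentiableOn ℂ F U ∧ Set.EqOn F t (U ∩ PGonTrig.polygon p) := by
  refine ⟨⟨_, PGonTrig.exists_isQuotientExtension hp⟩, ?_⟩
  rintro t ht a ha U hU haU ⟨F, hF, hFt⟩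
  exact PGonTrig.not_exists_extension_at_vertex hp ha hU haU hF
    (hFt.trans ((ht.eqOn_scInv hp).mono Set.inter_subset_right))
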